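/- Let $G=(V,E)$ be a finite, nonempty, simple, loopless, undirected graph and let $X\subseteq V$ (an assignment). Write $MC(H)$ and $MS(H)$ for the sets of maximal cliques and of maximal stable (independent) sets of a graph $H$. Put $G(X,0)$ if some $T\in MS(G)$ satisfies $X\cap T=\emptyset$, and $G(X,1)$ if some $S\in MC(G)$ satisfies $S\subseteq X$. A module of a graph is a set $M$ of its vertices such that all elements of $M$ have the same neighbours outside $M$; it is proper if it is not the whole vertex set. The decomposition tree $T(G)$ is defined by recursion on $|V|$. If $G$ has one vertex, $T(G)$ is a leaf labelled by that vertex. If $G$ is disconnected, the root is a $\vee$ node whose children are the decomposition trees of the connected components of $G$. If the complement $\overline G$ is disconnected, the root is a $\wedge$ node whose children are the decomposition trees of the subgraphs of $G$ induced by the vertex sets of the connected components of $\overline G$. Otherwise the root is a prime node labelled by the quotient graph $G/P$, where $P$ is the set of maximal proper modules of $G$ (they partition $V$), with two distinct $M,N\in P$ adjacent in $G/P$ when all vertices of $M$ are adjacent in $G$ to all vertices of $N$; the children are the decomposition trees of the subgraphs of $G$ induced by the $M\in P$. In the game on $G$, Eloise and Abelard build a path in $T(G)$ starting at the root. At a $\vee$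 node Eloise chooses a child and the play continues there; at a $\wedge$ node Abelard chooses a child and the play continues there. At a prime node with label $G'/P$, Eloise chooses some $S\in MC(G'/P)$ and Abelard chooses some $T\in MS(G'/P)$; the play continues at the child given by the unique module in $S\cap T$ if there is one, and if $S\cap T=\emptyset$ it ends with outcome $\emptyset$. At a leaf the play ends with the vertex labelling the leaf as its outcome. Under the assignment $X$, Eloise wins a play if its outcome is a vertex in $X$, Abelard wins it if its outcome is a vertex not in $X$, and a play with outcome $\emptyset$ is a draw. A reactionary strategy for Eloise assigns to each $\vee$ node of $T(G)$ one of its children, and to each prime node of $T(G)$, with label $G'/P$, a map $MS(G'/P)\to MC(G'/P)$ (her reply to Abelard's choice). Dually, a reactionary strategy for Abelard assigns to each $\wedge$ node one of its children, and to each prime node a map $MC(G'/P)\to MS(G'/P)$. A strategy of a player is winning with respect to $X$ if that player wins every play in which all of that player's choices are those prescribed by the strategy. Then: 1. $\neg G(X,0)$ if and only if Eloise has a reactionary strategy that is winning with respect to $X$. 2. $\neg G(X,1)$ if and only if Abelard has a reactionary strategy that is winning with respect to $X$. -/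

import Mathlib

namespace BGL

universe u

variable {V : Type u}

/-- The maximal cliques of a graph. -/
def MC (G : SimpleGraph V) : Set (Set V) := {S | Maximal G.IsClique S}

/-- The maximal stable (independent) sets of a graph. -/
def MS (G : SimpleGraph V) : Set (Set V) := {T | Maximal G.IsIndepSet T}

/-- The Boolean relation computed by a graph: `Evaluates G X b` is `G(X, b)`, where `false` is `0`
and `true` is `1`. -/
def Evaluates (G : SimpleGraph V) (X : Set V) : Bool → Prop
  | false => ∃ T ∈ MS G, X ∩ T = ∅
  | true => ∃ S ∈ MC G, S ⊆ X

/-- A module: all its elements have the same neighbours outside of it. -/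
def IsModule (G : SimpleGraph V) (M : Set V) : Prop :=
  ∀ x ∈ M, ∀ y ∈ M, ∀ z ∉ M, (G.Adj x z ↔ G.Adj y z)

/-- The maximal proper modules of a graph. -/
def maxProperModules (G : SimpleGraph V) : Set (Set V) :=
  {M | Maximal (fun N : Set V => IsModule G N ∧ N ≠ Set.univ) M}

/-- The quotient graph on a family `P` of sets of vertices: two different members are adjacent when
every vertex of one is adjacent to every vertex of the other. -/
def quotientGraph (G : SimpleGraph V) (P : Set (Set V)) : SimpleGraph P where
  Adj M N := M ≠ N ∧ ∀ x ∈ M.1, ∀ y ∈ N.1, G.Adj x y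
  symm := ⟨fun _ _ h => ⟨h.1.symm, fun x hx y hy => (h.2 y hy x hx).symm⟩⟩
  loopless := ⟨fun _ h => h.1 rfl⟩

/-- The graph is disconnected: its decomposition tree has root `∨`. -/
def IsParallel (G : SimpleGraph V) : Prop := ¬ G.Preconnected

/-- The complement is disconnected: the decomposition tree has root `∧`. -/
def IsSeries (G : SimpleGraph V) : Prop := ¬ Gᶜ.Preconnected

/-- More than one vertex, connected and co-connected: the decomposition tree has a prime root. -/
def IsBiconnected (G : SimpleGraph V) : Prop :=
  Nontrivial V ∧ G.Preconnected ∧ Gᶜ.Preconnected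

/-- The vertex sets of the graphs whose decomposition trees are the immediate subtrees of the
decomposition tree of `G`: the connected components, the connected components of the complement,
or the maximal proper modules. There are none if `G` has just one vertex. -/
def parts (G : SimpleGraph V) : Set (Set V) :=
  {M | (IsParallel G ∧ ∃ c : G.ConnectedComponent, M = c.supp) ∨
    (IsSeries G ∧ ∃ c : Gᶜ.ConnectedComponent, M = c.supp) ∨
    (IsBiconnected G ∧ M ∈ maxProperModules G)}

/-- The children of the induced subgraph of `G` on `U`, as sets of vertices of `G`. -/
def children (G : SimpleGraph V) (U : Set V) : Set (Set V) :=
  (fun M : Set U => Subtype.val '' M) '' parts (G.induce U)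

/-- The nodes of the decomposition tree, each given by the set of vertices (leaves) below it:
the root is the whole graph, and the children are as above. -/
inductive IsNode (G : SimpleGraph V) : Set V → Prop
  | root : IsNode G Set.univ
  | child {U W : Set V} : IsNode G U → W ∈ children G U → IsNode G W

/-- The type of nodes of the decomposition tree of `G`. -/
structure Node (G : SimpleGraph V) where
  verts : Set V
  isNode : IsNode G verts

namespace Node

variable {G : SimpleGraph V}

/-- The root of the decomposition tree. -/
def root (G : SimpleGraph V) : Node G := ⟨Set.univ, IsNode.root⟩

/-- The children of a node, as sets of vertices. -/
def parts (U : Node G) : Set (Set V) := children G U.verts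

/-- A child of a node, as a node. -/
def child (U : Node G) (W : U.parts) : Node G := ⟨W.1, IsNode.child U.isNode W.2⟩

/-- The node is labelled `∨`. -/
def IsOr (U : Node G) : Prop := IsParallel (G.induce U.verts)

/-- The node is labelled `∧`. -/
def IsAnd (U : Node G) : Prop := IsSeries (G.induce U.verts)

/-- The node is prime, labelled with a quotient graph. -/
def IsPrime (U : Node G) : Prop := IsBiconnected (G.induce U.verts)

/-- The quotient graph whose vertices are the children of the node. It is the label of the node if
the node is prime. -/
def quotient (U : Node G) : SimpleGraph U.parts := quotientGraph G U.parts

end Node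

/-- A play from a node of the decomposition tree: the choices of both players until a leaf or a
deadlock is reached. At a prime node Eloise chooses a maximal clique `S` and Abelard a maximal
stable set `T` of the quotient, and the play continues on the only element of `S ∩ T`, if any. -/
inductive Play (G : SimpleGraph V) : Node G → Type u
  | leaf (U : Node G) (x : V) (hx : U.verts = {x}) : Play G U
  | or (U : Node G) (hU : U.IsOr) (W : U.parts) (p : Play G (U.child W)) : Play G U
  | and (U : Node G) (hU : U.IsAnd) (W : U.parts) (p : Play G (U.child W)) : Play G U
  | prime (U : Node G) (hU : U.IsPrime) (S : MC U.quotient) (T : MS U.quotient)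
      (M : U.parts) (hM : S.1 ∩ T.1 = {M}) (p : Play G (U.child M)) : Play G U
  | deadlock (U : Node G) (hU : U.IsPrime) (S : MC U.quotient) (T : MS U.quotient)
      (h : S.1 ∩ T.1 = ∅) : Play G U

/-- The outcome of a play: a vertex, or `none` (the empty outcome) for a deadlock. -/
def Play.outcome {G : SimpleGraph V} : {U : Node G} → Play G U → Option V
  | _, .leaf _ x _ => some x
  | _, .or _ _ _ p => p.outcome
  | _, .and _ _ _ p => p.outcome
  | _, .prime _ _ _ _ _ _ p => p.outcome
  | _, .deadlock _ _ _ _ _ => none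

/-- Eloise wins a play under the assignment `X` if the outcome is a vertex in `X`. -/
def Play.EloiseWins {G : SimpleGraph V} {U : Node G} (X : Set V) (p : Play G U) : Prop :=
  ∃ x ∈ X, p.outcome = some x

/-- Abelard wins a play under the assignment `X` if the outcome is a vertex not in `X`. -/
def Play.AbelardWins {G : SimpleGraph V} {U : Node G} (X : Set V) (p : Play G U) : Prop :=
  ∃ x ∉ X, p.outcome = some x

/-- A reactionary strategy for Eloise: a child of every `∨` node and, at every prime node, a
maximal clique of the quotient in response to every maximal stable set that Abelard may choose. -/
structure EloiseReactionary (G : SimpleGraph V) where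
  atOr : (U : Node G) → U.IsOr → U.parts
  atPrime : (U : Node G) → U.IsPrime → MS U.quotient → MC U.quotient

/-- A reactionary strategy for Abelard: a child of every `∧` node and, at every prime node, a
maximal stable set of the quotient in response to every maximal clique that Eloise may choose. -/
structure AbelardReactionary (G : SimpleGraph V) where
  atAnd : (U : Node G) → U.IsAnd → U.parts
  atPrime : (U : Node G) → U.IsPrime → MC U.quotient → MS U.quotient

/-- All of Eloise's choices in the play are those of the strategy `σ`. -/
def EloiseReactionary.Follows {G : SimpleGraph V} (σ : EloiseReactionary G) :
    {U : Node G} → Play G U → Prop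
  | _, .leaf _ _ _ => True
  | _, .or U hU W p => W = σ.atOr U hU ∧ σ.Follows p
  | _, .and _ _ _ p => σ.Follows p
  | _, .prime U hU S T _ _ p => S = σ.atPrime U hU T ∧ σ.Follows p
  | _, .deadlock U hU S T _ => S = σ.atPrime U hU T

/-- All of Abelard's choices in the play are those of the strategy `σ`. -/
def AbelardReactionary.Follows {G : SimpleGraph V} (σ : AbelardReactionary G) :
    {U : Node G} → Play G U → Prop
  | _, .leaf _ _ _ => True
  | _, .or _ _ _ p => σ.Follows p
  | _, .and U hU W p => W = σ.atAnd U hU ∧ σ.Follows p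
  | _, .prime U hU S T _ _ p => T = σ.atPrime U hU S ∧ σ.Follows p
  | _, .deadlock U hU S T _ => T = σ.atPrime U hU S

/-- Every play of the game on `G` (from the root) according to `σ` is won by Eloise. -/
def EloiseReactionary.IsWinning {G : SimpleGraph V} (σ : EloiseReactionary G) (X : Set V) : Prop :=
  ∀ p : Play G (Node.root G), σ.Follows p → p.EloiseWins X

/-- Every play of the game on `G` (from the root) according to `σ` is won by Abelard. -/
def AbelardReactionary.IsWinning {G : SimpleGraph V} (σ : AbelardReactionary G) (X : Set V) :
    Prop :=
  ∀ p : Play G (Node.root G), σ.Follows p → p.AbelardWins X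

end BGL

namespace BGL
universe u
variable {V : Type u}

/-! The invariant is `MeetsKernels G X U`: every maximal stable set of the subgraph induced on the
node `U` meets `X`. At the root it says that $G(X,0)$ fails.

Eloise can preserve it. At a `∨` node some component inherits it, since otherwise bad stable sets of
all components would unite to a bad one of `U`; at a `∧` node every child inherits it. At a prime
node, for each maximal stable `T` of the quotient, composing stable sets over `T` shows that some `M
∈ T` inherits it (`MeetsKernels.exists_mem`), and a maximal clique through `M` meets `T` exactly in
`M`, so there is no deadlock. At a leaf the invariant puts the vertex in `X`.

Conversely, against any strategy of Eloise and for any maximal stable set `T` of `G`, Abelard can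
keep the play inside `T` by choosing traces of `T` (`EloiseReactionary.exists_play`). If the
strategy wins, the outcome lies in `T ∩ X`.

Abelard's half is the same argument for `Gᶜ` and `Xᶜ`, as modules are invariant under complement. -/

/-! ### Maximal stable sets as independent dominating sets, and their intersections with maximal
cliques. -/

/-- `T` is a maximal stable set of the subgraph of `G` induced on `U`. -/
structure IsKernelOn (G : SimpleGraph V) (U T : Set V) : Prop where
  subset : T ⊆ U
  indep : ∀ x ∈ T, ∀ y ∈ T, ¬ G.Adj x y
  exists_adj : ∀ x ∈ U, x ∉ T → ∃ y ∈ T, G.Adj x y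

theorem mem_MS_iff {G : SimpleGraph V} {T : Set V} :
    T ∈ MS G ↔ IsKernelOn G Set.univ T := by
  constructor
  · intro h
    have hi : ∀ x ∈ T, ∀ y ∈ T, ¬ G.Adj x y := fun x hx y hy hxy => h.1 hx hy hxy.ne hxy
    refine ⟨Set.subset_univ _, hi, fun x _ hx => ?_⟩
    by_contra! hn
    refine hx (h.2 (y := insert x T) ?_ (Set.subset_insert _ _) (Set.mem_insert _ _))
    rintro a (rfl | ha) b (rfl | hb) hab
    · exact absurd rfl hab
    · exact hn b hb
    · exact fun h' => hn a ha h'.symm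
    · exact hi a ha b hb
  · intro h
    refine ⟨fun x hx y hy _ => h.indep x hx y hy, fun T' hT' hTT' x hx => ?_⟩
    by_contra hxT
    obtain ⟨y, hy, hxy⟩ := h.exists_adj x trivial hxT
    exact hT' hx (hTT' hy) hxy.ne hxy

theorem mem_MC_iff {G : SimpleGraph V} {S : Set V} :
    S ∈ MC G ↔ IsKernelOn Gᶜ Set.univ S := by
  rw [← mem_MS_iff]
  simp only [MC, MS, Set.mem_ofPred_eq, Maximal, SimpleGraph.isIndepSet_compl]

theorem IsKernelOn.nonempty {G : SimpleGraph V} {U T : Set V} (h : IsKernelOn G U T)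
    (hU : U.Nonempty) : T.Nonempty := by
  obtain ⟨x, hx⟩ := hU
  by_cases hxT : x ∈ T
  · exact ⟨x, hxT⟩
  · obtain ⟨y, hy, -⟩ := h.exists_adj x hx hxT
    exact ⟨y, hy⟩

theorem isKernelOn_singleton (G : SimpleGraph V) (x : V) : IsKernelOn G {x} {x} :=
  ⟨subset_rfl, fun _ ha _ hb h => h.ne (ha.trans hb.symm), fun _ ha hn => absurd ha hn⟩

theorem exists_mem_MS_superset [Finite V] {G : SimpleGraph V} {A : Set V} (hA : G.IsIndepSet A) :
    ∃ T ∈ MS G, A ⊆ T :=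
  let ⟨T, h, hT⟩ := Finite.exists_le_maximal hA
  ⟨T, hT, h⟩

theorem exists_mem_MC_superset [Finite V] {G : SimpleGraph V} {A : Set V} (hA : G.IsClique A) :
    ∃ S ∈ MC G, A ⊆ S :=
  let ⟨S, h, hS⟩ := Finite.exists_le_maximal hA
  ⟨S, hS, h⟩

theorem inter_eq_empty_or_singleton {G : SimpleGraph V} {S T : Set V} (hS : S ∈ MC G)
    (hT : T ∈ MS G) : S ∩ T = ∅ ∨ ∃ x, S ∩ T = {x} := by
  rcases (S ∩ T).eq_empty_or_nonempty with h | ⟨x, hx⟩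
  · exact .inl h
  · refine .inr ⟨x, Set.eq_singleton_iff_unique_mem.2 ⟨hx, fun y hy => ?_⟩⟩
    by_contra hne
    exact hT.1 hy.2 hx.2 hne (hS.1 hy.1 hx.1 hne)

/-- Eloise's reply at a prime node: it steers the play to a chosen module of Abelard's stable set.
-/
theorem exists_MC_inter_eq_singleton [Finite V] {G : SimpleGraph V} {T : Set V} (hT : T ∈ MS G)
    {x : V} (hx : x ∈ T) : ∃ S ∈ MC G, S ∩ T = {x} := by
  obtain ⟨S, hS, hxS⟩ := exists_mem_MC_superset (G := G) (A := {x}) (by simp)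
  have hx' : x ∈ S ∩ T := ⟨hxS rfl, hx⟩
  rcases inter_eq_empty_or_singleton hS hT with h | ⟨y, h⟩
  · simp [h] at hx'
  · rw [h] at hx'
    obtain rfl : x = y := hx'
    exact ⟨S, hS, h⟩

theorem exists_MS_inter_eq_singleton [Finite V] {G : SimpleGraph V} {S : Set V} (hS : S ∈ MC G)
    {x : V} (hx : x ∈ S) : ∃ T ∈ MS G, S ∩ T = {x} := by
  obtain ⟨T, hT, hxT⟩ := exists_mem_MS_superset (G := G) (A := {x}) (by simp [SimpleGraph.IsIndepSet])
  have hx' : x ∈ S ∩ T := ⟨hx, hxT rfl⟩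
  rcases inter_eq_empty_or_singleton hS hT with h | ⟨y, h⟩
  · simp [h] at hx'
  · rw [h] at hx'
    obtain rfl : x = y := hx'
    exact ⟨T, hT, h⟩

/-! ### Modular partitions: restriction and composition of maximal stable sets. -/

/-- `P` is a partition of `U` into nonempty proper modules of the subgraph of `G` induced on `U`. -/
structure IsModularPartition (G : SimpleGraph V) (U : Set V) (P : Set (Set V)) : Prop where
  subset : ∀ W ∈ P, W ⊆ U
  ne : ∀ W ∈ P, W ≠ U
  nonempty : ∀ W ∈ P, W.Nonempty
  eq_of_mem : ∀ W ∈ P, ∀ W' ∈ P, ∀ x ∈ W, x ∈ W' → W = W'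
  exists_mem : ∀ x ∈ U, ∃ W ∈ P, x ∈ W
  adj_iff : ∀ W ∈ P, ∀ x ∈ W, ∀ y ∈ W, ∀ z ∈ U, z ∉ W → (G.Adj x z ↔ G.Adj y z)

namespace IsModularPartition

variable {G : SimpleGraph V} {U : Set V} {P : Set (Set V)}

theorem compl (h : IsModularPartition G U P) : IsModularPartition Gᶜ U P where
  subset := h.subset
  ne := h.ne
  nonempty := h.nonempty
  eq_of_mem := h.eq_of_mem
  exists_mem := h.exists_mem
  adj_iff W hW x hx y hy z hz hzW := by
    have hxz : x ≠ z := fun h => hzW (h ▸ hx)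
    have hyz : y ≠ z := fun h => hzW (h ▸ hy)
    simp [SimpleGraph.compl_adj, hxz, hyz, h.adj_iff W hW x hx y hy z hz hzW]

/-- The endpoints are moved one at a time, first inside `M` and then inside `N`, so one pair of
representatives decides adjacency. -/
theorem quotientGraph_adj (h : IsModularPartition G U P) {M N : P} (hMN : M ≠ N) {x y : V}
    (hx : x ∈ M.1) (hy : y ∈ N.1) : (quotientGraph G P).Adj M N ↔ G.Adj x y := by
  refine ⟨fun H => H.2 x hx y hy, fun H => ⟨hMN, fun x' hx' y' hy' => ?_⟩⟩
  have hne : M.1 ≠ N.1 := fun h => hMN (Subtype.ext h)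
  have hxN : x' ∉ N.1 := fun h' => hne (h.eq_of_mem _ M.2 _ N.2 x' hx' h')
  have hyM : y ∉ M.1 := fun h' => hne (h.eq_of_mem _ M.2 _ N.2 y h' hy)
  have h1 := (h.adj_iff M.1 M.2 x hx x' hx' y (h.subset _ N.2 hy) hyM).1 H
  exact ((h.adj_iff N.1 N.2 y hy y' hy' x' (h.subset _ M.2 hx') hxN).1 h1.symm).symm

/-- Turns cliques of the quotient into stable sets of the quotient of `Gᶜ`, to which the stable set
lemmas apply. -/
theorem compl_quotientGraph (h : IsModularPartition G U P) :
    (quotientGraph G P)ᶜ = quotientGraph Gᶜ P := by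
  ext M N
  rcases eq_or_ne M N with rfl | hMN
  · simp
  obtain ⟨x, hx⟩ := h.nonempty _ M.2
  obtain ⟨y, hy⟩ := h.nonempty _ N.2
  have hxy : x ≠ y := by
    rintro rfl
    exact hMN (Subtype.ext (h.eq_of_mem _ M.2 _ N.2 x hx hy))
  rw [h.compl.quotientGraph_adj hMN hx hy, SimpleGraph.compl_adj, SimpleGraph.compl_adj,
    h.quotientGraph_adj hMN hx hy]
  simp [hMN, hxy]

/-- A maximal stable set meets a module in a maximal stable set of the module, or not at all. -/
theorem isKernelOn_inter (h : IsModularPartition G U P) {T W : Set V} (hT : IsKernelOn G U T)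
    (hW : W ∈ P) (hTW : (T ∩ W).Nonempty) : IsKernelOn G W (T ∩ W) where
  subset := Set.inter_subset_right
  indep x hx y hy := hT.indep x hx.1 y hy.1
  exists_adj x hx hxT := by
    obtain ⟨y, hy, hxy⟩ := hT.exists_adj x (h.subset W hW hx) fun h' => hxT ⟨h', hx⟩
    by_cases hyW : y ∈ W
    · exact ⟨y, ⟨hy, hyW⟩, hxy⟩
    · obtain ⟨z, hz⟩ := hTW
      exact absurd ((h.adj_iff W hW x hx z hz.2 y (hT.subset hy) hyW).1 hxy)
        (hT.indep z hz.1 y hy)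

/-- The trace on the quotient of a maximal stable set. -/
theorem isKernelOn_trace (h : IsModularPartition G U P) {T : Set V} (hT : IsKernelOn G U T) :
    IsKernelOn (quotientGraph G P) Set.univ {M | (T ∩ M.1).Nonempty} where
  subset := Set.subset_univ _
  indep := by
    rintro M ⟨x, hx⟩ N ⟨y, hy⟩ hMN
    exact hT.indep x hx.1 y hy.1 (hMN.2 x hx.2 y hy.2)
  exists_adj M _ hM := by
    obtain ⟨x, hx⟩ := h.nonempty _ M.2
    obtain ⟨y, hy, hxy⟩ := hT.exists_adj x (h.subset _ M.2 hx) fun h' => hM ⟨x, h', hx⟩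
    obtain ⟨N, hN, hyN⟩ := h.exists_mem y (hT.subset hy)
    have hMN : M ≠ ⟨N, hN⟩ := by
      rintro rfl
      exact hM ⟨y, hy, hyN⟩
    exact ⟨⟨N, hN⟩, ⟨y, hy, hyN⟩, (h.quotientGraph_adj hMN hx hyN).2 hxy⟩

/-- Maximal stable sets of the modules in a maximal stable set of the quotient compose to a
maximal stable set. -/
theorem isKernelOn_iUnion (h : IsModularPartition G U P) {T : Set P}
    (hT : IsKernelOn (quotientGraph G P) Set.univ T) {f : P → Set V}
    (hf : ∀ M ∈ T, IsKernelOn G M.1 (f M)) : IsKernelOn G U (⋃ M ∈ T, f M) where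
  subset := Set.iUnion₂_subset fun M hM => (hf M hM).subset.trans (h.subset _ M.2)
  indep := by
    simp only [Set.mem_iUnion]
    rintro x ⟨M, hM, hx⟩ y ⟨N, hN, hy⟩ hxy
    rcases eq_or_ne M N with rfl | hMN
    · exact (hf M hM).indep x hx y hy hxy
    · exact hT.indep M hM N hN
        ((h.quotientGraph_adj hMN ((hf M hM).subset hx) ((hf N hN).subset hy)).2 hxy)
  exists_adj x hx hxT := by
    simp only [Set.mem_iUnion, not_exists, exists_prop] at hxT ⊢
    obtain ⟨M, hM, hxM⟩ := h.exists_mem x hx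
    by_cases hMT : ⟨M, hM⟩ ∈ T
    · obtain ⟨y, hy, hxy⟩ := (hf _ hMT).exists_adj x hxM fun h' => hxT _ ⟨hMT, h'⟩
      exact ⟨y, ⟨_, hMT, hy⟩, hxy⟩
    · obtain ⟨N, hN, hMN⟩ := hT.exists_adj ⟨M, hM⟩ trivial hMT
      obtain ⟨y, hy⟩ := (hf N hN).nonempty (h.nonempty _ N.2)
      exact ⟨y, ⟨N, hN, hy⟩, hMN.2 x hxM y ((hf N hN).subset hy)⟩

end IsModularPartition

/-! ### The children of a node form a modular partition. -/

theorem isModule_union {G : SimpleGraph V} {M N : Set V} (hM : IsModule G M) (hN : IsModule G N)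
    (hMN : (M ∩ N).Nonempty) : IsModule G (M ∪ N) := by
  obtain ⟨b, hb⟩ := hMN
  have key : ∀ x ∈ M ∪ N, ∀ z ∉ M ∪ N, (G.Adj x z ↔ G.Adj b z) := by
    rintro x (hx | hx) z hz
    · exact hM x hx b hb.1 z fun h => hz (.inl h)
    · exact hN x hx b hb.2 z fun h => hz (.inr h)
  exact fun x hx y hy z hz => (key x hx z hz).trans (key y hy z hz).symm

theorem not_preconnected_of_cut {G : SimpleGraph V} {M : Set V} {a c : V} (ha : a ∈ M)
    (hc : c ∉ M) (h : ∀ x ∈ M, ∀ y ∉ M, ¬ G.Adj x y) : ¬ G.Preconnected := by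
  intro hG
  obtain ⟨p⟩ := hG a c
  obtain ⟨d, -, h1, h2⟩ := p.exists_boundary_dart M ha hc
  exact h _ h1 _ h2 d.adj

/-- Two distinct overlapping maximal modules have a union that is a module, hence everything. Then
all pairs across the cut between `M` and its complement are adjacent or none is, so `Gᶜ` or `G` is
disconnected. -/
theorem IsBiconnected.maxProperModules_eq_of_mem {G : SimpleGraph V} (hG : IsBiconnected G)
    {M N : Set V} (hM : M ∈ maxProperModules G) (hN : N ∈ maxProperModules G) {b : V}
    (hbM : b ∈ M) (hbN : b ∈ N) : M = N := by
  by_contra hne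
  have hMN : ¬ M ⊆ N := fun h => hne (h.antisymm (hM.2 hN.1 h))
  have hNM : ¬ N ⊆ M := fun h => hne ((hN.2 hM.1 h).antisymm h)
  obtain ⟨a, ha, haN⟩ := Set.not_subset.1 hMN
  obtain ⟨c, hc, hcM⟩ := Set.not_subset.1 hNM
  have hU : M ∪ N = Set.univ := by
    by_contra hU
    exact hcM (hM.2 ⟨isModule_union hM.1.1 hN.1.1 ⟨b, hbM, hbN⟩, hU⟩ Set.subset_union_left
      (Or.inr hc))
  have hmem : ∀ y ∉ M, y ∈ N := fun y hy =>
    (hU ▸ Set.mem_univ y : y ∈ M ∪ N).resolve_left hy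
  have key : ∀ x ∈ M, ∀ y ∉ M, (G.Adj x y ↔ G.Adj a c) := fun x hx y hy =>
    (hM.1.1 x hx a ha y hy).trans <| by
      rw [G.adj_comm a y, G.adj_comm a c]
      exact hN.1.1 y (hmem y hy) c hc a haN
  by_cases hac : G.Adj a c
  · exact not_preconnected_of_cut (G := Gᶜ) ha hcM (fun x hx y hy h => h.2 ((key x hx y hy).2 hac)) hG.2.2
  · exact not_preconnected_of_cut ha hcM (fun x hx y hy h => hac ((key x hx y hy).1 h)) hG.2.1

/-- Makes the three clauses of `parts` mutually exclusive. -/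
theorem not_isSeries_of_isParallel {G : SimpleGraph V} (h : IsParallel G) : ¬ IsSeries G :=
  fun h' => G.connected_or_preconnected_compl.elim (fun hc => h hc.preconnected) h'

theorem parts_of_isParallel {G : SimpleGraph V} (h : IsParallel G) :
    parts G = {M | ∃ c : G.ConnectedComponent, M = c.supp} := by
  ext M
  simp [parts, h, not_isSeries_of_isParallel h, show ¬ IsBiconnected G from fun h' => h h'.2.1]

theorem parts_of_isSeries {G : SimpleGraph V} (h : IsSeries G) :
    parts G = {M | ∃ c : Gᶜ.ConnectedComponent, M = c.supp} := by
  ext M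
  simp [parts, h, show ¬ IsParallel G from fun h' => not_isSeries_of_isParallel h' h,
    show ¬ IsBiconnected G from fun h' => h h'.2.2]

theorem parts_of_isBiconnected {G : SimpleGraph V} (h : IsBiconnected G) :
    parts G = maxProperModules G := by
  ext M
  simp [parts, h, show ¬ IsParallel G from fun h' => h' h.2.1,
    show ¬ IsSeries G from fun h' => h' h.2.2]

theorem not_adj_of_mem_supp {G : SimpleGraph V} {c : G.ConnectedComponent} {x y : V}
    (hx : x ∈ c.supp) (hy : y ∉ c.supp) : ¬ G.Adj x y :=
  fun h => hy ((SimpleGraph.ConnectedComponent.mem_supp_congr_adj c h).1 hx)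

theorem isModularPartition_components {G : SimpleGraph V} (h : ¬ G.Preconnected) :
    IsModularPartition G Set.univ {M | ∃ c : G.ConnectedComponent, M = c.supp} where
  subset _ _ := Set.subset_univ _
  ne := by
    rintro _ ⟨c, rfl⟩ hc
    refine h fun x y => SimpleGraph.ConnectedComponent.exact ?_
    have hx : x ∈ c.supp := hc ▸ Set.mem_univ x
    have hy : y ∈ c.supp := hc ▸ Set.mem_univ y
    exact (Eq.trans hx (Eq.symm hy) :)
  nonempty := by
    rintro _ ⟨c, rfl⟩
    exact c.nonempty_supp
  eq_of_mem := by
    rintro _ ⟨c, rfl⟩ _ ⟨c', rfl⟩ x hx hx'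
    exact congrArg _ ((Eq.symm hx).trans hx')
  exists_mem x _ := ⟨_, ⟨G.connectedComponentMk x, rfl⟩, rfl⟩
  adj_iff := by
    rintro _ ⟨c, rfl⟩ x hx y hy z - hz
    exact iff_of_false (not_adj_of_mem_supp hx hz) (not_adj_of_mem_supp hy hz)

theorem isModularPartition_maxProperModules [Finite V] {G : SimpleGraph V}
    (h : IsBiconnected G) : IsModularPartition G Set.univ (maxProperModules G) := by
  have := h.1
  have hs (x : V) : ∃ W ∈ maxProperModules G, x ∈ W := by
    obtain ⟨W, hxW, hW⟩ := Finite.exists_le_maximal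
      (p := fun N : Set V => IsModule G N ∧ N ≠ Set.univ) (a := {x})
      ⟨by rintro _ rfl _ rfl z _; rfl, Set.singleton_ne_univ x⟩
    exact ⟨W, hW, hxW rfl⟩
  exact {
    subset := fun _ _ => Set.subset_univ _
    ne := fun W hW => hW.1.2
    nonempty := fun W hW => by
      obtain ⟨x⟩ : Nonempty V := inferInstance
      obtain ⟨N, hN, hx⟩ := hs x
      -- The empty set is a proper module, but it lies below the nonempty `N` and so is not maximal.
      rw [Set.nonempty_iff_ne_empty]
      rintro rfl
      exact hW.2 hN.1 (Set.empty_subset _) hx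
    eq_of_mem := fun W hW W' hW' x hx hx' => h.maxProperModules_eq_of_mem hW hW' hx hx'
    exists_mem := fun x _ => hs x
    adj_iff := fun W hW x hx y hy z _ hz => hW.1.1 x hx y hy z hz }

theorem isModularPartition_parts [Finite V] [Nontrivial V] (G : SimpleGraph V) :
    IsModularPartition G Set.univ (parts G) := by
  by_cases hp : IsParallel G
  · rw [parts_of_isParallel hp]
    exact isModularPartition_components hp
  by_cases hs : IsSeries G
  · rw [parts_of_isSeries hs]
    simpa using (isModularPartition_components hs).compl
  · have hb : IsBiconnected G := ⟨‹_›, not_not.1 hp, not_not.1 hs⟩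
    rw [parts_of_isBiconnected hb]
    exact isModularPartition_maxProperModules hb

variable {G : SimpleGraph V} {U : Set V}

theorem isModularPartition_children [Finite V] (G : SimpleGraph V) (hU : U.Nontrivial) :
    IsModularPartition G U (children G U) := by
  have := Set.nontrivial_coe_sort.2 hU
  have h := isModularPartition_parts (G.induce U)
  refine ⟨?_, ?_, ?_, ?_, ?_, ?_⟩
  · rintro _ ⟨M, -, rfl⟩
    exact Subtype.coe_image_subset U M
  · rintro _ ⟨M, hM, rfl⟩ he
    refine h.ne M hM (Set.eq_univ_of_forall fun x => ?_)
    obtain ⟨y, hy, hyx⟩ := he.ge x.2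
    rwa [← Subtype.ext hyx]
  · rintro _ ⟨M, hM, rfl⟩
    exact (h.nonempty M hM).image _
  · rintro _ ⟨M, hM, rfl⟩ _ ⟨N, hN, rfl⟩ _ ⟨x, hx, rfl⟩ ⟨y, hy, hyx⟩
    obtain rfl := Subtype.ext hyx
    rw [h.eq_of_mem M hM N hN y hx hy]
  · intro x hx
    obtain ⟨M, hM, hxM⟩ := h.exists_mem ⟨x, hx⟩ trivial
    exact ⟨_, ⟨M, hM, rfl⟩, _, hxM, rfl⟩
  · rintro _ ⟨M, hM, rfl⟩ _ ⟨x, hx, rfl⟩ _ ⟨y, hy, rfl⟩ z hz hzM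
    exact h.adj_iff M hM x hx y hy ⟨z, hz⟩ trivial fun h' => hzM ⟨_, h', rfl⟩

theorem nontrivial_of_not_preconnected {H : SimpleGraph V} (h : ¬ H.Preconnected) :
    Nontrivial V := by
  by_contra hn
  rw [not_nontrivial_iff_subsingleton] at hn
  exact h fun x y => Subsingleton.elim x y ▸ SimpleGraph.Reachable.refl x

theorem nontrivial_of_isParallel (h : IsParallel (G.induce U)) : U.Nontrivial :=
  Set.nontrivial_coe_sort.1 (nontrivial_of_not_preconnected h)

theorem nontrivial_of_isSeries (h : IsSeries (G.induce U)) : U.Nontrivial :=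
  Set.nontrivial_coe_sort.1 (nontrivial_of_not_preconnected h)

theorem nontrivial_of_isBiconnected (h : IsBiconnected (G.induce U)) : U.Nontrivial :=
  Set.nontrivial_coe_sort.1 h.1

theorem not_adj_of_isParallel (h : IsParallel (G.induce U)) {W : Set V} (hW : W ∈ children G U)
    {x y : V} (hx : x ∈ W) (hy : y ∈ U) (hyW : y ∉ W) : ¬ G.Adj x y := by
  obtain ⟨M, hM, rfl⟩ := hW
  rw [parts_of_isParallel h] at hM
  obtain ⟨c, rfl⟩ := hM
  obtain ⟨x, hx, rfl⟩ := hx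
  exact not_adj_of_mem_supp (G := G.induce U) (y := ⟨y, hy⟩) hx fun h' => hyW ⟨_, h', rfl⟩

theorem adj_of_isSeries (h : IsSeries (G.induce U)) {W : Set V} (hW : W ∈ children G U)
    {x y : V} (hx : x ∈ W) (hy : y ∈ U) (hyW : y ∉ W) : G.Adj x y := by
  obtain ⟨M, hM, rfl⟩ := hW
  rw [parts_of_isSeries h] at hM
  obtain ⟨c, rfl⟩ := hM
  obtain ⟨x, hx, rfl⟩ := hx
  have hn := not_adj_of_mem_supp (y := ⟨y, hy⟩) hx fun h' => hyW ⟨_, h', rfl⟩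
  by_contra hxy
  refine hn ⟨?_, hxy⟩
  rintro rfl
  exact hyW ⟨_, hx, rfl⟩

/-! ### Nodes labelled `∨`, and dually `∧` through the complement. -/

/-- Maximal stable sets when there are no edges between different modules. -/
structure IsEdgelessBetween (G : SimpleGraph V) (U : Set V) (P : Set (Set V)) : Prop where
  part : IsModularPartition G U P
  not_adj : ∀ W ∈ P, ∀ x ∈ W, ∀ y ∈ U, y ∉ W → ¬ G.Adj x y

namespace IsEdgelessBetween

variable {P : Set (Set V)}

/-- A vertex of `W` outside `T` has its neighbour in `T` within `W`, so `T` cannot miss `W`. -/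
theorem isKernelOn_inter (h : IsEdgelessBetween G U P) {T W : Set V} (hT : IsKernelOn G U T)
    (hW : W ∈ P) : IsKernelOn G W (T ∩ W) := by
  refine h.part.isKernelOn_inter hT hW ?_
  obtain ⟨x, hx⟩ := h.part.nonempty W hW
  by_cases hxT : x ∈ T
  · exact ⟨x, hxT, hx⟩
  · obtain ⟨y, hy, hxy⟩ := hT.exists_adj x (h.part.subset W hW hx) hxT
    by_contra hn
    exact h.not_adj W hW x hx y (hT.subset hy) (fun hyW => hn ⟨y, hy, hyW⟩) hxy

/-- The quotient has no edges, so its whole vertex set is a maximal stable set to compose over. -/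
theorem isKernelOn_iUnion (h : IsEdgelessBetween G U P) {f : P → Set V}
    (hf : ∀ M : P, IsKernelOn G M.1 (f M)) : IsKernelOn G U (⋃ M, f M) := by
  have huniv : IsKernelOn (quotientGraph G P) Set.univ Set.univ := by
    refine ⟨subset_rfl, fun M _ N _ hMN => ?_, fun _ _ h' => absurd trivial h'⟩
    obtain ⟨x, hx⟩ := h.part.nonempty _ M.2
    obtain ⟨y, hy⟩ := h.part.nonempty _ N.2
    refine h.not_adj _ M.2 x hx y (h.part.subset _ N.2 hy) (fun hyM => ?_) (hMN.2 x hx y hy)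
    exact hMN.1 (Subtype.ext (h.part.eq_of_mem _ M.2 _ N.2 y hyM hy))
  simpa using h.part.isKernelOn_iUnion huniv fun M _ => hf M

/-- In the complement, a maximal stable set of a module is one of the whole. -/
theorem isKernelOn_compl (h : IsEdgelessBetween G U P) {T W : Set V} (hW : W ∈ P)
    (hT : IsKernelOn Gᶜ W T) : IsKernelOn Gᶜ U T where
  subset := hT.subset.trans (h.part.subset W hW)
  indep := hT.indep
  exists_adj x hx hxT := by
    by_cases hxW : x ∈ W
    · exact hT.exists_adj x hxW hxT
    · obtain ⟨y, hy⟩ := hT.nonempty (h.part.nonempty W hW)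
      have hyW := hT.subset hy
      exact ⟨y, hy, fun he => hxW (he ▸ hyW), fun hxy => h.not_adj W hW y hyW x hx hxW hxy.symm⟩

/-- In the complement, every maximal stable set is contained in a module. -/
theorem exists_isKernelOn_compl (h : IsEdgelessBetween G U P) {T : Set V} (hU : U.Nonempty)
    (hT : IsKernelOn Gᶜ U T) : ∃ W ∈ P, IsKernelOn Gᶜ W T := by
  obtain ⟨x, hx⟩ := hT.nonempty hU
  obtain ⟨W, hW, hxW⟩ := h.part.exists_mem x (hT.subset hx)
  have hTW : T ⊆ W := fun y hy => by
    by_contra hyW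
    exact hT.indep x hx y hy
      ⟨fun he => hyW (he ▸ hxW), h.not_adj W hW x hxW y (hT.subset hy) hyW⟩
  have := h.part.compl.isKernelOn_inter hT hW ⟨x, hx, hxW⟩
  rw [Set.inter_eq_left.2 hTW] at this
  exact ⟨W, hW, this⟩

end IsEdgelessBetween

theorem IsParallel.isEdgelessBetween [Finite V] (h : IsParallel (G.induce U)) :
    IsEdgelessBetween G U (children G U) :=
  ⟨isModularPartition_children G (nontrivial_of_isParallel h),
    fun _ hW _ hx _ hy hyW => not_adj_of_isParallel h hW hx hy hyW⟩

theorem IsSeries.isEdgelessBetween [Finite V] (h : IsSeries (G.induce U)) :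
    IsEdgelessBetween Gᶜ U (children G U) :=
  ⟨(isModularPartition_children G (nontrivial_of_isSeries h)).compl,
    fun _ hW _ hx _ hy hyW h' => h'.2 (adj_of_isSeries h hW hx hy hyW)⟩


/-! ### The invariant and its passage to children. -/

/-- Every maximal stable set of the subgraph of `G` induced on `U` meets `X`. -/
def MeetsKernels (G : SimpleGraph V) (X U : Set V) : Prop :=
  ∀ T, IsKernelOn G U T → ∃ x ∈ T, x ∈ X

theorem MeetsKernels.exists_of_isEdgelessBetween {X : Set V} {P : Set (Set V)}
    (h : MeetsKernels G X U) (hP : IsEdgelessBetween G U P) : ∃ W : P, MeetsKernels G X W.1 := by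
  by_contra! hn
  simp only [MeetsKernels, not_forall] at hn
  choose f hf hfX using hn
  obtain ⟨x, hx, hxX⟩ := h _ (hP.isKernelOn_iUnion hf)
  obtain ⟨M, hM⟩ := Set.mem_iUnion.1 hx
  exact hfX M ⟨x, hM, hxX⟩

theorem MeetsKernels.of_isEdgelessBetween_compl {X : Set V} {P : Set (Set V)}
    (h : MeetsKernels Gᶜ X U) (hP : IsEdgelessBetween G U P) {W : Set V} (hW : W ∈ P) :
    MeetsKernels Gᶜ X W :=
  fun T hT => h T (hP.isKernelOn_compl hW hT)

theorem MeetsKernels.exists_mem {X : Set V} {P : Set (Set V)} (h : MeetsKernels G X U)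
    (hP : IsModularPartition G U P) {T : Set P}
    (hT : IsKernelOn (quotientGraph G P) Set.univ T) : ∃ M ∈ T, MeetsKernels G X M.1 := by
  by_contra! hn
  have hn' : ∀ M : P, ∃ S, M ∈ T → IsKernelOn G M.1 S ∧ ¬ ∃ x ∈ S, x ∈ X := fun M => by
    by_cases hM : M ∈ T
    · have := hn M hM
      simp only [MeetsKernels, not_forall] at this
      obtain ⟨S, hS, hSX⟩ := this
      exact ⟨S, fun _ => ⟨hS, hSX⟩⟩
    -- Modules outside `T` do not enter the union, so any value serves.
    · exact ⟨∅, fun h => absurd h hM⟩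
  choose f hf using hn'
  obtain ⟨x, hx, hxX⟩ := h _ (hP.isKernelOn_iUnion hT fun M hM => (hf M hM).1)
  simp only [Set.mem_iUnion, exists_prop] at hx
  obtain ⟨M, hM, hxM⟩ := hx
  exact (hf M hM).2 ⟨x, hxM, hxX⟩

/-- A strategy must prescribe a move even at nodes where the invariant fails; there the choice is
arbitrary. -/
theorem exists_imp_of_imp_exists {α : Sort*} [Nonempty α] {p : Prop} {q : α → Prop}
    (h : p → ∃ a, q a) : ∃ a, p → q a :=
  Classical.byCases (fun hp => let ⟨a, ha⟩ := h hp; ⟨a, fun _ => ha⟩)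
    fun hp => ⟨Classical.arbitrary α, fun h' => absurd h' hp⟩

theorem Node.IsPrime.mem_MS_iff {U : Node G} {T : Set U.parts} :
    T ∈ MS U.quotient ↔ IsKernelOn (quotientGraph G U.parts) Set.univ T :=
  BGL.mem_MS_iff

theorem IsModularPartition.ssubset {P : Set (Set V)} (h : IsModularPartition G U P) (W : P) :
    W.1 ⊂ U :=
  (h.subset _ W.2).ssubset_of_ne (h.ne _ W.2)

theorem IsModularPartition.nonempty_of_nonempty {P : Set (Set V)} (h : IsModularPartition G U P)
    (hU : U.Nonempty) : Nonempty P :=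
  let ⟨x, hx⟩ := hU
  let ⟨W, hW, _⟩ := h.exists_mem x hx
  ⟨⟨W, hW⟩⟩

theorem not_evaluates_false_iff {G : SimpleGraph V} {X : Set V} :
    ¬ Evaluates G X false ↔ MeetsKernels G X Set.univ := by
  simp only [Evaluates, MeetsKernels, mem_MS_iff, not_exists, not_and, ← Set.nonempty_iff_ne_empty,
    ← ne_eq]
  exact forall₂_congr fun T _ => ⟨fun ⟨x, h, h'⟩ => ⟨x, h', h⟩, fun ⟨x, h, h'⟩ => ⟨x, h', h⟩⟩

theorem not_evaluates_true_iff {G : SimpleGraph V} {X : Set V} :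
    ¬ Evaluates G X true ↔ MeetsKernels Gᶜ Xᶜ Set.univ := by
  simp only [Evaluates, MeetsKernels, mem_MC_iff, not_exists, not_and, Set.not_subset,
    Set.mem_compl_iff]

variable [Finite V]

/-! ### Nodes of the decomposition tree. -/

namespace Node

theorem verts_nonempty [Nonempty V] (U : Node G) : U.verts.Nonempty := by
  obtain ⟨U, hU⟩ := U
  change U.Nonempty
  induction hU with
  | root => exact Set.univ_nonempty
  | child _ hW ih =>
    rename_i U W _
    obtain ⟨x, rfl⟩ | h := ih.exists_eq_singleton_or_nontrivial
    · obtain ⟨M, hM, rfl⟩ := hW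
      -- A one-vertex node has no children: each clause of `parts` forces two vertices.
      have hs (H : SimpleGraph ({x} : Set V)) : H.Preconnected := fun a b =>
        Subsingleton.elim a b ▸ .refl a
      rcases hM with ⟨h, -⟩ | ⟨h, -⟩ | ⟨h, -⟩
      · exact absurd (hs _) h
      · exact absurd (hs _) h
      · exact absurd h.1 (not_nontrivial _)
    · exact (isModularPartition_children G h).nonempty W hW

theorem IsPrime.part {U : Node G} (hU : U.IsPrime) : IsModularPartition G U.verts U.parts :=
  isModularPartition_children G (nontrivial_of_isBiconnected hU)

theorem IsOr.edgeless {U : Node G} (hU : U.IsOr) : IsEdgelessBetween G U.verts U.parts :=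
  IsParallel.isEdgelessBetween hU

theorem IsAnd.edgeless {U : Node G} (hU : U.IsAnd) : IsEdgelessBetween Gᶜ U.verts U.parts :=
  IsSeries.isEdgelessBetween hU

theorem singleton_or_isOr_or_isAnd_or_isPrime [Nonempty V] (U : Node G) :
    (∃ x, U.verts = {x}) ∨ U.IsOr ∨ U.IsAnd ∨ U.IsPrime := by
  rcases U.verts_nonempty.exists_eq_singleton_or_nontrivial with h | h
  · exact .inl h
  · by_cases ho : U.IsOr
    · exact .inr (.inl ho)
    by_cases ha : U.IsAnd
    · exact .inr (.inr (.inl ha))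
    · exact .inr (.inr (.inr ⟨Set.nontrivial_coe_sort.2 h, not_not.1 ho, not_not.1 ha⟩))

theorem IsPrime.mem_MC_iff {U : Node G} (hU : U.IsPrime) {S : Set U.parts} :
    S ∈ MC U.quotient ↔ IsKernelOn (quotientGraph Gᶜ U.parts) Set.univ S := by
  rw [BGL.mem_MC_iff, ← hU.part.compl_quotientGraph]
  rfl

theorem child_induction {motive : Node G → Prop}
    (h : ∀ U : Node G, (∀ W : U.parts, W.1 ⊂ U.verts → motive (U.child W)) → motive U)
    (U : Node G) : motive U := by
  induction hn : U.verts.ncard using Nat.strong_induction_on generalizing U with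
  | _ n ih =>
    subst hn
    exact h U fun W hW => ih _ (Set.ncard_lt_ncard hW (Set.toFinite _)) _ rfl

end Node

/-! ### Counterplays against a given strategy. -/

/-- Abelard's counterplay. The set `T` shrinks to a maximal stable set of each node visited; a
deadlock satisfies the conclusion vacuously. -/
theorem EloiseReactionary.exists_play [Nonempty V] (σ : EloiseReactionary G) (U : Node G) :
    ∀ T, IsKernelOn G U.verts T →
      ∃ p : Play G U, σ.Follows p ∧ ∀ x, p.outcome = some x → x ∈ T := by
  induction U using Node.child_induction with
  | h U ih =>
  intro T hT
  rcases U.singleton_or_isOr_or_isAnd_or_isPrime with ⟨x, hx⟩ | hU | hU | hU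
  · refine ⟨.leaf U x hx, trivial, fun y hy => ?_⟩
    obtain rfl : x = y := Option.some.inj hy
    obtain ⟨z, hz⟩ := hT.nonempty U.verts_nonempty
    obtain rfl : z = x := hx.le (hT.subset hz)
    exact hz
  · obtain ⟨p, hp, hpT⟩ := ih (σ.atOr U hU) (hU.edgeless.part.ssubset _) _
      (hU.edgeless.isKernelOn_inter hT (σ.atOr U hU).2)
    exact ⟨.or U hU _ p, ⟨rfl, hp⟩, fun x hx => (hpT x hx).1⟩
  · have hT' : IsKernelOn Gᶜᶜ U.verts T := by rwa [compl_compl]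
    obtain ⟨W, hW, hTW⟩ := hU.edgeless.exists_isKernelOn_compl U.verts_nonempty hT'
    rw [compl_compl] at hTW
    obtain ⟨p, hp, hpT⟩ := ih ⟨W, hW⟩ (hU.edgeless.part.ssubset _) _ hTW
    exact ⟨.and U hU _ p, hp, hpT⟩
  -- Abelard chooses the set of modules met by `T`; if the play continues at `M`, then `T ∩ M` is
  -- again maximal stable there.
  · have hT' := Node.IsPrime.mem_MS_iff.2 (hU.part.isKernelOn_trace hT)
    rcases inter_eq_empty_or_singleton (σ.atPrime U hU ⟨_, hT'⟩).2 hT' with h | ⟨M, h⟩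
    · exact ⟨.deadlock U hU _ ⟨_, hT'⟩ h, rfl, fun x hx => nomatch hx⟩
    · have hM : (T ∩ M.1).Nonempty := (h.ge rfl).2
      obtain ⟨p, hp, hpT⟩ := ih M (hU.part.ssubset _) _ (hU.part.isKernelOn_inter hT M.2 hM)
      exact ⟨.prime U hU _ ⟨_, hT'⟩ M h p, ⟨rfl, hp⟩, fun x hx => (hpT x hx).1⟩

theorem AbelardReactionary.exists_play [Nonempty V] (σ : AbelardReactionary G) (U : Node G) :
    ∀ S, IsKernelOn Gᶜ U.verts S →
      ∃ p : Play G U, σ.Follows p ∧ ∀ x, p.outcome = some x → x ∈ S := by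
  induction U using Node.child_induction with
  | h U ih =>
  intro S hS
  rcases U.singleton_or_isOr_or_isAnd_or_isPrime with ⟨x, hx⟩ | hU | hU | hU
  · refine ⟨.leaf U x hx, trivial, fun y hy => ?_⟩
    obtain rfl : x = y := Option.some.inj hy
    obtain ⟨z, hz⟩ := hS.nonempty U.verts_nonempty
    obtain rfl : z = x := hx.le (hS.subset hz)
    exact hz
  · obtain ⟨W, hW, hSW⟩ := hU.edgeless.exists_isKernelOn_compl U.verts_nonempty hS
    obtain ⟨p, hp, hpS⟩ := ih ⟨W, hW⟩ (hU.edgeless.part.ssubset _) _ hSW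
    exact ⟨.or U hU _ p, hp, hpS⟩
  · obtain ⟨p, hp, hpS⟩ := ih (σ.atAnd U hU) (hU.edgeless.part.ssubset _) _
      (hU.edgeless.isKernelOn_inter hS (σ.atAnd U hU).2)
    exact ⟨.and U hU _ p, ⟨rfl, hp⟩, fun x hx => (hpS x hx).1⟩
  · have hS' := hU.mem_MC_iff.2 (hU.part.compl.isKernelOn_trace hS)
    rcases inter_eq_empty_or_singleton hS' (σ.atPrime U hU ⟨_, hS'⟩).2 with h | ⟨M, h⟩
    · exact ⟨.deadlock U hU ⟨_, hS'⟩ _ h, rfl, fun x hx => nomatch hx⟩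
    · have hM : (S ∩ M.1).Nonempty := (h.ge rfl).1
      obtain ⟨p, hp, hpS⟩ := ih M (hU.part.ssubset _) _ (hU.part.compl.isKernelOn_inter hS M.2 hM)
      exact ⟨.prime U hU ⟨_, hS'⟩ _ M h p, ⟨rfl, hp⟩, fun x hx => (hpS x hx).1⟩

/-! ### Strategies that preserve the invariant. -/

/-- One strategy serves all nodes, which lets the induction run over plays from an arbitrary node.
-/
theorem exists_eloiseReactionary [Nonempty V] (G : SimpleGraph V) (X : Set V) :
    ∃ σ : EloiseReactionary G, ∀ {U : Node G} (p : Play G U), σ.Follows p →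
      MeetsKernels G X U.verts → p.EloiseWins X := by
  have hor (U : Node G) (hU : U.IsOr) :
      ∃ W : U.parts, MeetsKernels G X U.verts → MeetsKernels G X W.1 := by
    have := hU.edgeless.part.nonempty_of_nonempty U.verts_nonempty
    exact exists_imp_of_imp_exists fun h => h.exists_of_isEdgelessBetween hU.edgeless
  have hprime (U : Node G) (hU : U.IsPrime) (T : MS U.quotient) : ∃ S : MC U.quotient,
      MeetsKernels G X U.verts → ∃ M, S.1 ∩ T.1 = {M} ∧ MeetsKernels G X M.1 := by
    have : Nonempty (MC U.quotient) :=
      let ⟨S, hS, _⟩ := exists_mem_MC_superset (G := U.quotient) (A := ∅) (by simp)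
      ⟨⟨S, hS⟩⟩
    refine exists_imp_of_imp_exists fun h => ?_
    obtain ⟨M, hM, hMX⟩ := h.exists_mem hU.part (Node.IsPrime.mem_MS_iff.1 T.2)
    obtain ⟨S, hS, hST⟩ := exists_MC_inter_eq_singleton T.2 hM
    exact ⟨⟨S, hS⟩, M, hST, hMX⟩
  choose f hf using hor
  choose g hg using hprime
  refine ⟨⟨f, g⟩, fun {U} p => ?_⟩
  induction p with
  | leaf U x hx =>
    intro _ h
    rw [hx] at h
    obtain ⟨y, rfl, hy⟩ := h _ (isKernelOn_singleton G x)
    exact ⟨y, hy, rfl⟩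
  | or U hU W p ih =>
    rintro ⟨rfl, hp⟩ h
    exact ih hp (hf U hU h)
  | and U hU W p ih =>
    intro hp h
    refine ih hp ?_
    have h' : MeetsKernels Gᶜᶜ X U.verts := by rwa [compl_compl]
    have hW := h'.of_isEdgelessBetween_compl hU.edgeless W.2
    rwa [compl_compl] at hW
  | prime U hU S T M hM p ih =>
    rintro ⟨rfl, hp⟩ h
    obtain ⟨N, hN, hNX⟩ := hg U hU T h
    -- The play can only continue at the module to which the reply was aimed.
    obtain rfl : M = N := Set.singleton_injective (hM.symm.trans hN)
    exact ih hp hNX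
  | deadlock U hU S T hST =>
    intro hS h
    replace hS : S = g U hU T := hS
    rw [hS] at hST
    obtain ⟨N, hN, -⟩ := hg U hU T h
    exact absurd (hN.symm.trans hST) (Set.singleton_ne_empty N)

theorem exists_abelardReactionary [Nonempty V] (G : SimpleGraph V) (X : Set V) :
    ∃ σ : AbelardReactionary G, ∀ {U : Node G} (p : Play G U), σ.Follows p →
      MeetsKernels Gᶜ Xᶜ U.verts → p.AbelardWins X := by
  have hand (U : Node G) (hU : U.IsAnd) :
      ∃ W : U.parts, MeetsKernels Gᶜ Xᶜ U.verts → MeetsKernels Gᶜ Xᶜ W.1 := by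
    have := hU.edgeless.part.nonempty_of_nonempty U.verts_nonempty
    exact exists_imp_of_imp_exists fun h => h.exists_of_isEdgelessBetween hU.edgeless
  -- Eloise's clique is a stable set of the quotient of `Gᶜ`; Abelard aims at a module in it that
  -- keeps the dual invariant.
  have hprime (U : Node G) (hU : U.IsPrime) (S : MC U.quotient) : ∃ T : MS U.quotient,
      MeetsKernels Gᶜ Xᶜ U.verts → ∃ M, S.1 ∩ T.1 = {M} ∧ MeetsKernels Gᶜ Xᶜ M.1 := by
    have : Nonempty (MS U.quotient) :=
      let ⟨T, hT, _⟩ := exists_mem_MS_superset (G := U.quotient) (A := ∅)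
        (by simp [SimpleGraph.IsIndepSet])
      ⟨⟨T, hT⟩⟩
    refine exists_imp_of_imp_exists fun h => ?_
    obtain ⟨M, hM, hMX⟩ := h.exists_mem hU.part.compl (hU.mem_MC_iff.1 S.2)
    obtain ⟨T, hT, hST⟩ := exists_MS_inter_eq_singleton S.2 hM
    exact ⟨⟨T, hT⟩, M, hST, hMX⟩
  choose f hf using hand
  choose g hg using hprime
  refine ⟨⟨f, g⟩, fun {U} p => ?_⟩
  induction p with
  | leaf U x hx =>
    intro _ h
    rw [hx] at h
    obtain ⟨y, rfl, hy⟩ := h _ (isKernelOn_singleton Gᶜ x)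
    exact ⟨y, hy, rfl⟩
  | or U hU W p ih =>
    intro hp h
    exact ih hp (h.of_isEdgelessBetween_compl hU.edgeless W.2)
  | and U hU W p ih =>
    rintro ⟨rfl, hp⟩ h
    exact ih hp (hf U hU h)
  | prime U hU S T M hM p ih =>
    rintro ⟨rfl, hp⟩ h
    obtain ⟨N, hN, hNX⟩ := hg U hU S h
    obtain rfl : M = N := Set.singleton_injective (hM.symm.trans hN)
    exact ih hp hNX
  | deadlock U hU S T hST =>
    intro hT h
    replace hT : T = g U hU S := hT
    rw [hT] at hST
    obtain ⟨N, hN, -⟩ := hg U hU S h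
    exact absurd (hN.symm.trans hST) (Set.singleton_ne_empty N)

end BGL

theorem mainTheorem7 {V : Type*} [Finite V] [Nonempty V] (G : SimpleGraph V) (X : Set V) :
    (¬ BGL.Evaluates G X false ↔ ∃ σ : BGL.EloiseReactionary G, σ.IsWinning X) ∧
    (¬ BGL.Evaluates G X true ↔ ∃ σ : BGL.AbelardReactionary G, σ.IsWinning X) := by
  rw [BGL.not_evaluates_false_iff, BGL.not_evaluates_true_iff]
  refine ⟨⟨fun h => ?_, ?_⟩, fun h => ?_, ?_⟩
  · obtain ⟨σ, hσ⟩ := BGL.exists_eloiseReactionary G X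
    exact ⟨σ, fun p hp => hσ p hp h⟩
  · rintro ⟨σ, hσ⟩ T hT
    obtain ⟨p, hp, hpT⟩ := σ.exists_play (.root G) T hT
    -- Winning rules out a deadlock, so the counterplay has an outcome, lying in both `T` and `X`.
    obtain ⟨x, hx, hpx⟩ := hσ p hp
    exact ⟨x, hpT x hpx, hx⟩
  · obtain ⟨σ, hσ⟩ := BGL.exists_abelardReactionary G X
    exact ⟨σ, fun p hp => hσ p hp h⟩
  · rintro ⟨σ, hσ⟩ S hS
    obtain ⟨p, hp, hpS⟩ := σ.exists_play (.root G) S hS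
    obtain ⟨x, hx, hpx⟩ := hσ p hp
    exact ⟨x, hpS x hpx, hx⟩
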